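/- Let $H$ be a complex $m\times n$ matrix which is a contraction (its operator norm with respect to the Euclidean norms satisfies $\|H\|\le 1$, equivalently $H^*H\le I_n$), and let $L$ be a self-adjoint complex $n\times n$ matrix. Then the (real-valued) function \[ \varphi(A)=\operatorname{Tr}\exp\bigl(L+H^*\log(A)H\bigr) \] is concave on the convex set of positive definite complex $m\times m$ matrices $A$; that is, $\varphi(tA+(1-t)B)\ge t\varphi(A)+(1-t)\varphi(B)$ for all positive definite $A,B$ and all $t\in[0,1]$. -/

import Mathlib

open scoped Matrix ComplexOrder

section Contraction

open scoped Matrix.Norms.L2Operator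

/-- A (possibly rectangular) complex matrix is a contraction if its operator norm with respect to
the Euclidean norms is at most one. -/
def IsContraction {m n : Type*} [Fintype m] [Fintype n] [DecidableEq n]
    (H : Matrix m n ℂ) : Prop :=
  ‖H‖ ≤ 1

end Contraction

/-- The logarithm of a positive definite matrix, through the (continuous) functional calculus of
Hermitian matrices: apply `Real.log` to the eigenvalues. -/
noncomputable def matrixLog {m : Type*} [Fintype m] [DecidableEq m]
    (A : Matrix m m ℂ) : Matrix m m ℂ :=
  cfc Real.log A

/-- The function `A ↦ Tr exp (L + H* log(A) H)`, where `L` is `n × n`, `H` is `m × n` and `A` is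
`m × m`. -/
noncomputable def traceExpLog {m n : Type*} [Fintype m] [DecidableEq m] [Fintype n]
    [DecidableEq n] (H : Matrix m n ℂ) (L : Matrix n n ℂ) (A : Matrix m m ℂ) : ℂ :=
  (NormedSpace.exp (L + Hᴴ * matrixLog A * H)).trace

namespace Matrix

variable {m n : Type*} [Fintype m] [DecidableEq m] [Fintype n] [DecidableEq n]

/-! By the Gibbs variational principle (`gibbsFunctional_le`, `gibbsFunctional_exp`), `Tr exp M` is
the maximum over positive definite `X` of `Tr (M X) - Tr (X log X) + Tr X`. Partial maximization
preserves joint concavity, so for `M = L + H* log(A) H` it suffices that this expression is jointly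
concave in `(A, X)`. Since `H` is a contraction, `1 - H* H = K* K`, and the expression is a linear
function of `X` minus the weighted relative entropies of `(H, A, X)` and `(K, 1, X)`.

Joint convexity of these entropies (`weightedRelEntropy_combo_le`) comes from an integral over `s`
of the forms `⟨HX, (s R_X + L_A)⁻¹ HX⟩`. Each is a maximum over `Z` of functions linear in `(A, X)`,
hence jointly convex. -/

lemma IsHermitian.cfc_eq_mul_diagonal_mul {A : Matrix m m ℂ} (hA : A.IsHermitian) (f : ℝ → ℝ) :
    cfc f A = (hA.eigenvectorUnitary : Matrix m m ℂ) *
      diagonal (fun i => (f (hA.eigenvalues i) : ℂ)) *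
      (hA.eigenvectorUnitary : Matrix m m ℂ)ᴴ := by
  rw [hA.cfc_eq, IsHermitian.cfc, Unitary.conjStarAlgAut_apply]
  rfl

lemma IsHermitian.exp_eq_cfc {A : Matrix m m ℂ} (hA : A.IsHermitian) :
    NormedSpace.exp A = cfc Real.exp A := by
  set U : Matrix m m ℂ := hA.eigenvectorUnitary.val with hU
  have hUU : U * Uᴴ = 1 := Unitary.coe_mul_star_self hA.eigenvectorUnitary
  have hinv : U⁻¹ = Uᴴ := inv_eq_right_inv hUU
  have hunit : IsUnit U := IsUnit.of_mul_eq_one _ hUU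
  have h1 : A = U * diagonal (fun i => (hA.eigenvalues i : ℂ)) * U⁻¹ := by
    conv_lhs => rw [hA.spectral_theorem, Unitary.conjStarAlgAut_apply]
    rw [hinv]; rfl
  rw [hA.cfc_eq_mul_diagonal_mul]
  conv_lhs => rw [h1, exp_conj _ _ hunit, exp_diagonal, hinv]
  congr 3
  ext i
  simp [← Complex.exp_eq_exp_ℂ]

/-! ### Traces in a pair of eigenbases -/

/-- The matrix of `H` in the eigenbases of `X` and `A`. -/
noncomputable def eigenCoord {A : Matrix m m ℂ} {X : Matrix n n ℂ}
    (hA : A.IsHermitian) (hX : X.IsHermitian) (H : Matrix m n ℂ) : Matrix m n ℂ :=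
  (hA.eigenvectorUnitary : Matrix m m ℂ)ᴴ * H * (hX.eigenvectorUnitary : Matrix n n ℂ)

/-- Left multiplication by `f(A)` and right multiplication by `g(X)` commute and are both diagonal
in the eigencoordinates, which reduces every trace below to a scalar sum. -/
lemma trace_mul_cfc_mul_cfc {A : Matrix m m ℂ} {X : Matrix n n ℂ}
    (hA : A.IsHermitian) (hX : X.IsHermitian) (Z H : Matrix m n ℂ) (f g : ℝ → ℝ) :
    (Zᴴ * cfc f A * H * cfc g X).trace =
      ∑ i, ∑ j, star (eigenCoord hA hX Z i j) * eigenCoord hA hX H i j *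
        ((f (hA.eigenvalues i) * g (hX.eigenvalues j) : ℝ) : ℂ) := by
  rw [hA.cfc_eq_mul_diagonal_mul, hX.cfc_eq_mul_diagonal_mul]
  set V : Matrix m m ℂ := hA.eigenvectorUnitary.val with hV
  set U : Matrix n n ℂ := hX.eigenvectorUnitary.val with hU
  have h : (Zᴴ * (V * diagonal (fun i => (f (hA.eigenvalues i) : ℂ)) * Vᴴ) * H *
      (U * diagonal (fun i => (g (hX.eigenvalues i) : ℂ)) * Uᴴ)).trace =
      ((eigenCoord hA hX Z)ᴴ * (diagonal (fun i => (f (hA.eigenvalues i) : ℂ)) *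
      (eigenCoord hA hX H * diagonal (fun i => (g (hX.eigenvalues i) : ℂ))))).trace := by
    rw [← Matrix.mul_assoc _ _ Uᴴ, trace_mul_comm]
    simp only [eigenCoord, conjTranspose_mul, conjTranspose_conjTranspose, Matrix.mul_assoc, ← hV,
      ← hU]
  rw [h, trace, Finset.sum_comm]
  refine Finset.sum_congr rfl fun j _ => ?_
  rw [diag_apply, mul_apply]
  refine Finset.sum_congr rfl fun i _ => ?_
  rw [diagonal_mul, mul_diagonal, conjTranspose_apply]
  push_cast
  ring

lemma re_trace_mul_cfc_mul_cfc_self {A : Matrix m m ℂ} {X : Matrix n n ℂ}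
    (hA : A.IsHermitian) (hX : X.IsHermitian) (H : Matrix m n ℂ) (f g : ℝ → ℝ) :
    (Hᴴ * cfc f A * H * cfc g X).trace.re =
      ∑ i, ∑ j, Complex.normSq (eigenCoord hA hX H i j) *
        (f (hA.eigenvalues i) * g (hX.eigenvalues j)) := by
  rw [trace_mul_cfc_mul_cfc hA hX, Complex.re_sum]
  refine Finset.sum_congr rfl fun i _ => ?_
  rw [Complex.re_sum]
  refine Finset.sum_congr rfl fun j _ => ?_
  rw [Complex.re_mul_ofReal, mul_comm (star _), Complex.star_def, Complex.mul_conj,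
    Complex.ofReal_re]

lemma IsHermitian.cfc_id_eq {A : Matrix m m ℂ} (hA : A.IsHermitian) : cfc (fun x : ℝ => x) A = A :=
  cfc_id' ℝ A hA

lemma IsHermitian.cfc_one_eq {A : Matrix m m ℂ} (hA : A.IsHermitian) :
    cfc (fun _ : ℝ => (1 : ℝ)) A = 1 :=
  cfc_const_one ℝ A hA

lemma eigenCoord_surjective {A : Matrix m m ℂ} {X : Matrix n n ℂ}
    (hA : A.IsHermitian) (hX : X.IsHermitian) (Y : Matrix m n ℂ) :
    ∃ Z, eigenCoord hA hX Z = Y := by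
  have h1 : (hA.eigenvectorUnitary : Matrix m m ℂ)ᴴ * (hA.eigenvectorUnitary : Matrix m m ℂ) = 1 :=
    Unitary.coe_star_mul_self hA.eigenvectorUnitary
  have h2 : (hX.eigenvectorUnitary : Matrix n n ℂ)ᴴ * (hX.eigenvectorUnitary : Matrix n n ℂ) = 1 :=
    Unitary.coe_star_mul_self hX.eigenvectorUnitary
  refine ⟨(hA.eigenvectorUnitary : Matrix m m ℂ) * Y * (hX.eigenvectorUnitary : Matrix n n ℂ)ᴴ, ?_⟩
  rw [eigenCoord, Matrix.mul_assoc, Matrix.mul_assoc, h2, Matrix.mul_one, ← Matrix.mul_assoc, h1,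
    Matrix.one_mul]

/-! ### Joint convexity of the resolvent form -/

/-- The quadratic functional whose supremum over `Z` is `⟨HX, (s R_X + L_A)⁻¹ HX⟩`. -/
noncomputable def resolventFunctional (s : ℝ) (H Z : Matrix m n ℂ) (A : Matrix m m ℂ)
    (X : Matrix n n ℂ) : ℝ :=
  2 * (Zᴴ * H * X).trace.re - (Zᴴ * A * Z).trace.re - s * (Zᴴ * Z * X).trace.re

/-- The quadratic form `⟨HX, (s R_X + L_A)⁻¹ HX⟩` in eigencoordinates, where `L_A` and `R_X` are
left multiplication by `A` and right multiplication by `X`. -/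
noncomputable def resolventForm (s : ℝ) (H : Matrix m n ℂ) {A : Matrix m m ℂ} {X : Matrix n n ℂ}
    (hA : A.IsHermitian) (hX : X.IsHermitian) : ℝ :=
  ∑ i, ∑ j, Complex.normSq (eigenCoord hA hX H i j) *
    (hX.eigenvalues j ^ 2 / (s * hX.eigenvalues j + hA.eigenvalues i))

lemma resolventFunctional_eq_sum (s : ℝ) (H Z : Matrix m n ℂ) {A : Matrix m m ℂ}
    {X : Matrix n n ℂ} (hA : A.IsHermitian) (hX : X.IsHermitian) :
    resolventFunctional s H Z A X = ∑ i, ∑ j,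
      (2 * (star (eigenCoord hA hX Z i j) * eigenCoord hA hX H i j).re * hX.eigenvalues j -
        Complex.normSq (eigenCoord hA hX Z i j) *
          (s * hX.eigenvalues j + hA.eigenvalues i)) := by
  have h1 := congrArg Complex.re
    (trace_mul_cfc_mul_cfc hA hX Z H (fun _ => (1 : ℝ)) (fun x : ℝ => x))
  have h2 := re_trace_mul_cfc_mul_cfc_self hA hX Z (fun x : ℝ => x) (fun _ => (1 : ℝ))
  have h3 := re_trace_mul_cfc_mul_cfc_self hA hX Z (fun _ => (1 : ℝ)) (fun x : ℝ => x)
  simp only [hA.cfc_id_eq, hA.cfc_one_eq, hX.cfc_id_eq, hX.cfc_one_eq, Matrix.mul_one, one_mul,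
    mul_one, Complex.re_sum, Complex.re_mul_ofReal] at h1 h2 h3
  rw [resolventFunctional, h1, h2, h3, Finset.mul_sum, Finset.mul_sum, ← Finset.sum_sub_distrib,
    ← Finset.sum_sub_distrib]
  refine Finset.sum_congr rfl fun i _ => ?_
  rw [Finset.mul_sum, Finset.mul_sum, ← Finset.sum_sub_distrib, ← Finset.sum_sub_distrib]
  refine Finset.sum_congr rfl fun j _ => ?_
  ring

lemma resolventFunctional_le_resolventForm {s : ℝ} (hs : 0 ≤ s) (H Z : Matrix m n ℂ)
    {A : Matrix m m ℂ} {X : Matrix n n ℂ} (hA : A.PosDef) (hX : X.PosDef) :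
    resolventFunctional s H Z A X ≤ resolventForm s H hA.isHermitian hX.isHermitian := by
  rw [resolventFunctional_eq_sum s H Z hA.isHermitian hX.isHermitian, resolventForm]
  refine Finset.sum_le_sum fun i _ => Finset.sum_le_sum fun j _ => ?_
  have ha := hA.eigenvalues_pos i
  have hx := hX.eigenvalues_pos j
  set a := hA.isHermitian.eigenvalues i
  set x := hX.isHermitian.eigenvalues j
  have hd : 0 < s * x + a := by positivity
  generalize eigenCoord _ _ Z i j = z
  generalize eigenCoord _ _ H i j = w
  rw [← mul_div_assoc, le_div_iff₀ hd]
  simp only [Complex.star_def, Complex.normSq_apply, Complex.mul_re, Complex.conj_re,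
    Complex.conj_im]
  -- Completing the square: `|w x - z (s x + a)|² ≥ 0`.
  nlinarith [sq_nonneg (w.re * x - z.re * (s * x + a)), sq_nonneg (w.im * x - z.im * (s * x + a))]

lemma exists_resolventFunctional_eq {s : ℝ} (hs : 0 ≤ s) (H : Matrix m n ℂ)
    {A : Matrix m m ℂ} {X : Matrix n n ℂ} (hA : A.PosDef) (hX : X.PosDef) :
    ∃ Z, resolventFunctional s H Z A X = resolventForm s H hA.isHermitian hX.isHermitian := by
  -- The entrywise maximizer `z = w x / (s x + a)`, where that square vanishes.
  obtain ⟨Z, hZ⟩ := eigenCoord_surjective hA.isHermitian hX.isHermitian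
    (of fun i j => eigenCoord hA.isHermitian hX.isHermitian H i j *
      ((hX.isHermitian.eigenvalues j /
        (s * hX.isHermitian.eigenvalues j + hA.isHermitian.eigenvalues i) : ℝ) : ℂ))
  refine ⟨Z, ?_⟩
  rw [resolventFunctional_eq_sum s H Z hA.isHermitian hX.isHermitian, resolventForm, hZ]
  refine Finset.sum_congr rfl fun i _ => Finset.sum_congr rfl fun j _ => ?_
  have ha := hA.eigenvalues_pos i
  have hx := hX.eigenvalues_pos j
  rw [of_apply]
  set a := hA.isHermitian.eigenvalues i
  set x := hX.isHermitian.eigenvalues j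
  have hd : s * x + a ≠ 0 := by positivity
  generalize eigenCoord _ _ H i j = w
  simp only [Complex.star_def, Complex.normSq_apply, Complex.mul_re, Complex.conj_re, Complex.mul_im,
    Complex.conj_im, Complex.ofReal_re, Complex.ofReal_im]
  field_simp
  ring

lemma resolventFunctional_combo {ι κ : Type*} [Fintype ι] [Fintype κ] (s c d : ℝ)
    (H Z : Matrix ι κ ℂ) (A B : Matrix ι ι ℂ) (X Y : Matrix κ κ ℂ) :
    resolventFunctional s H Z (c • A + d • B) (c • X + d • Y) =
      c * resolventFunctional s H Z A X + d * resolventFunctional s H Z B Y := by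
  simp only [resolventFunctional, Matrix.mul_add, Matrix.add_mul, Matrix.mul_smul, Matrix.smul_mul,
    trace_add, trace_smul, Complex.add_re, Complex.smul_re, smul_eq_mul]
  ring

lemma PosDef.combo {ι : Type*} {A B : Matrix ι ι ℂ} (hA : A.PosDef) (hB : B.PosDef) {c d : ℝ}
    (hc : 0 ≤ c) (hd : 0 ≤ d) (hcd : c + d = 1) : (c • A + d • B).PosDef := by
  rcases hc.eq_or_lt with rfl | hc
  · obtain rfl : d = 1 := by linarith
    simpa using hB
  · exact (hA.smul hc).add_posSemidef (hB.posSemidef.smul hd)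

/-- A maximum of linear functions is convex: the `Z` optimal at the combined point is a competitor
at both endpoints. -/
lemma resolventForm_combo_le {s : ℝ} (hs : 0 ≤ s) (H : Matrix m n ℂ) {A B : Matrix m m ℂ}
    {X Y : Matrix n n ℂ} (hA : A.PosDef) (hB : B.PosDef) (hX : X.PosDef) (hY : Y.PosDef)
    {c d : ℝ} (hc : 0 ≤ c) (hd : 0 ≤ d) (hcd : c + d = 1) :
    resolventForm s H (hA.combo hB hc hd hcd).isHermitian (hX.combo hY hc hd hcd).isHermitian ≤
      c * resolventForm s H hA.isHermitian hX.isHermitian +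
        d * resolventForm s H hB.isHermitian hY.isHermitian := by
  obtain ⟨Z, hZ⟩ := exists_resolventFunctional_eq hs H (hA.combo hB hc hd hcd)
    (hX.combo hY hc hd hcd)
  rw [← hZ, resolventFunctional_combo]
  gcongr
  · exact resolventFunctional_le_resolventForm hs H Z hA hX
  · exact resolventFunctional_le_resolventForm hs H Z hB hY

/-! ### Relative entropy as a limit of integrals -/

lemma hasDerivAt_mul_log_affine {x a s : ℝ} (hx : 0 < x) (ha : 0 < a) (hs : 0 ≤ s) :
    HasDerivAt (fun s => x * Real.log (s * x + a)) (x ^ 2 / (s * x + a)) s := by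
  have hd : s * x + a ≠ 0 := by positivity
  have h := ((((hasDerivAt_id s).mul_const x).add_const a).log hd).const_mul x
  refine h.congr_deriv ?_
  simp only [id]
  ring

lemma continuousOn_sq_div_affine {x a T : ℝ} (hx : 0 < x) (ha : 0 < a) (hT : 0 ≤ T) :
    ContinuousOn (fun s : ℝ => x ^ 2 / (s * x + a)) (Set.uIcc 0 T) := by
  refine ContinuousOn.div (by fun_prop) (by fun_prop) fun s hs => ?_
  rw [Set.uIcc_of_le hT] at hs
  have := hs.1
  positivity

lemma integral_sq_div_affine {x a T : ℝ} (hx : 0 < x) (ha : 0 < a) (hT : 0 ≤ T) :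
    ∫ s in (0 : ℝ)..T, x ^ 2 / (s * x + a) = x * Real.log (T * x + a) - x * Real.log a := by
  rw [intervalIntegral.integral_eq_sub_of_hasDerivAt
    (f := fun s => x * Real.log (s * x + a))
    (fun s hs => hasDerivAt_mul_log_affine hx ha (by rw [Set.uIcc_of_le hT] at hs; exact hs.1))
    (continuousOn_sq_div_affine hx ha hT).intervalIntegrable]
  simp

lemma continuousOn_resolventForm (H : Matrix m n ℂ) {A : Matrix m m ℂ} {X : Matrix n n ℂ}
    (hA : A.PosDef) (hX : X.PosDef) {T : ℝ} (hT : 0 ≤ T) :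
    ContinuousOn (fun s => resolventForm s H hA.isHermitian hX.isHermitian) (Set.uIcc 0 T) := by
  unfold resolventForm
  exact continuousOn_finsetSum _ fun i _ => continuousOn_finsetSum _ fun j _ =>
    (continuousOn_sq_div_affine (hX.eigenvalues_pos j) (hA.eigenvalues_pos i) hT).const_mul _

lemma integral_resolventForm (H : Matrix m n ℂ) {A : Matrix m m ℂ} {X : Matrix n n ℂ}
    (hA : A.PosDef) (hX : X.PosDef) {T : ℝ} (hT : 0 ≤ T) :
    ∫ s in (0 : ℝ)..T, resolventForm s H hA.isHermitian hX.isHermitian =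
      ∑ i, ∑ j, Complex.normSq (eigenCoord hA.isHermitian hX.isHermitian H i j) *
        (hX.isHermitian.eigenvalues j *
            Real.log (T * hX.isHermitian.eigenvalues j + hA.isHermitian.eigenvalues i) -
          hX.isHermitian.eigenvalues j * Real.log (hA.isHermitian.eigenvalues i)) := by
  have hint : ∀ i j, IntervalIntegrable (fun s : ℝ =>
      Complex.normSq (eigenCoord hA.isHermitian hX.isHermitian H i j) *
      (hX.isHermitian.eigenvalues j ^ 2 /
        (s * hX.isHermitian.eigenvalues j + hA.isHermitian.eigenvalues i)))
      MeasureTheory.volume 0 T := fun i j =>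
    ((continuousOn_sq_div_affine (hX.eigenvalues_pos j)
      (hA.eigenvalues_pos i) hT).const_mul _).intervalIntegrable
  unfold resolventForm
  rw [intervalIntegral.integral_finsetSum fun i _ => ?_]
  · refine Finset.sum_congr rfl fun i _ => ?_
    rw [intervalIntegral.integral_finsetSum fun j _ => hint i j]
    refine Finset.sum_congr rfl fun j _ => ?_
    rw [intervalIntegral.integral_const_mul,
      integral_sq_div_affine (hX.eigenvalues_pos j) (hA.eigenvalues_pos i) hT]
  · exact (continuousOn_finsetSum _ fun j _ => (continuousOn_sq_div_affine (hX.eigenvalues_pos j)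
      (hA.eigenvalues_pos i) hT).const_mul _).intervalIntegrable

/-- The weighted relative entropy `Tr (H* H X log X) - Tr (H* log(A) H X)`. -/
noncomputable def weightedRelEntropy (H : Matrix m n ℂ) (A : Matrix m m ℂ) (X : Matrix n n ℂ) : ℝ :=
  (Hᴴ * H * cfc (fun x : ℝ => x * Real.log x) X).trace.re - (Hᴴ * cfc Real.log A * H * X).trace.re

lemma weightedRelEntropy_eq_sum (H : Matrix m n ℂ) {A : Matrix m m ℂ} {X : Matrix n n ℂ}
    (hA : A.IsHermitian) (hX : X.IsHermitian) :
    weightedRelEntropy H A X = ∑ i, ∑ j, Complex.normSq (eigenCoord hA hX H i j) *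
      (hX.eigenvalues j * Real.log (hX.eigenvalues j) -
        hX.eigenvalues j * Real.log (hA.eigenvalues i)) := by
  have h1 := re_trace_mul_cfc_mul_cfc_self hA hX H (fun _ => (1 : ℝ)) (fun x => x * Real.log x)
  have h2 := re_trace_mul_cfc_mul_cfc_self hA hX H Real.log (fun x : ℝ => x)
  simp only [hA.cfc_one_eq, hX.cfc_id_eq, Matrix.mul_one, one_mul] at h1 h2
  rw [weightedRelEntropy, h1, h2, ← Finset.sum_sub_distrib]
  refine Finset.sum_congr rfl fun i _ => ?_
  rw [← Finset.sum_sub_distrib]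
  refine Finset.sum_congr rfl fun j _ => ?_
  ring

/-- Splitting `log (T x + a) = log T + log (x + a / T)` isolates the divergence as `T → ∞`; the
subtracted term is linear in `X`, so it does not affect convexity. -/
lemma integral_resolventForm_sub_log (H : Matrix m n ℂ) {A : Matrix m m ℂ} {X : Matrix n n ℂ}
    (hA : A.PosDef) (hX : X.PosDef) {T : ℝ} (hT : 0 < T) :
    (∫ s in (0 : ℝ)..T, resolventForm s H hA.isHermitian hX.isHermitian) -
        Real.log T * (Hᴴ * H * X).trace.re =
      ∑ i, ∑ j, Complex.normSq (eigenCoord hA.isHermitian hX.isHermitian H i j) *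
        (hX.isHermitian.eigenvalues j *
            Real.log (hX.isHermitian.eigenvalues j + hA.isHermitian.eigenvalues i / T) -
          hX.isHermitian.eigenvalues j * Real.log (hA.isHermitian.eigenvalues i)) := by
  have h1 := re_trace_mul_cfc_mul_cfc_self hA.isHermitian hX.isHermitian H (fun _ => (1 : ℝ))
    (fun x : ℝ => x)
  simp only [hA.isHermitian.cfc_one_eq, hX.isHermitian.cfc_id_eq, Matrix.mul_one, one_mul] at h1
  rw [integral_resolventForm H hA hX hT.le, h1, Finset.mul_sum, ← Finset.sum_sub_distrib]
  refine Finset.sum_congr rfl fun i _ => ?_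
  rw [Finset.mul_sum, ← Finset.sum_sub_distrib]
  refine Finset.sum_congr rfl fun j _ => ?_
  have ha := hA.eigenvalues_pos i
  have hx := hX.eigenvalues_pos j
  set a := hA.isHermitian.eigenvalues i
  set x := hX.isHermitian.eigenvalues j
  have h : T * x + a = T * (x + a / T) := by field_simp
  have hp : x + a / T ≠ 0 := by positivity
  rw [h, Real.log_mul hT.ne' hp]
  ring

open Filter Topology in
lemma tendsto_integral_resolventForm_sub_log (H : Matrix m n ℂ) {A : Matrix m m ℂ}
    {X : Matrix n n ℂ} (hA : A.PosDef) (hX : X.PosDef) :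
    Tendsto (fun T : ℝ => (∫ s in (0 : ℝ)..T, resolventForm s H hA.isHermitian hX.isHermitian) -
      Real.log T * (Hᴴ * H * X).trace.re) atTop (𝓝 (weightedRelEntropy H A X)) := by
  rw [weightedRelEntropy_eq_sum H hA.isHermitian hX.isHermitian]
  refine Tendsto.congr' (f₁ := fun T => ∑ i, ∑ j,
    Complex.normSq (eigenCoord hA.isHermitian hX.isHermitian H i j) *
        (hX.isHermitian.eigenvalues j *
            Real.log (hX.isHermitian.eigenvalues j + hA.isHermitian.eigenvalues i / T) -
          hX.isHermitian.eigenvalues j * Real.log (hA.isHermitian.eigenvalues i))) ?_ ?_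
  · filter_upwards [eventually_gt_atTop 0] with T hT
    exact (integral_resolventForm_sub_log H hA hX hT).symm
  · refine tendsto_finsetSum _ fun i _ => tendsto_finsetSum _ fun j _ => ?_
    refine ((Tendsto.const_mul _ (Tendsto.log ?_ (hX.eigenvalues_pos j).ne')).sub_const _).const_mul _
    simpa using (tendsto_id.const_div_atTop (hA.isHermitian.eigenvalues i)).const_add
      (hX.isHermitian.eigenvalues j)

lemma weightedRelEntropy_combo_le (H : Matrix m n ℂ) {A B : Matrix m m ℂ}
    {X Y : Matrix n n ℂ} (hA : A.PosDef) (hB : B.PosDef) (hX : X.PosDef) (hY : Y.PosDef)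
    {c d : ℝ} (hc : 0 ≤ c) (hd : 0 ≤ d) (hcd : c + d = 1) :
    weightedRelEntropy H (c • A + d • B) (c • X + d • Y) ≤
      c * weightedRelEntropy H A X + d * weightedRelEntropy H B Y := by
  refine le_of_tendsto_of_tendsto
    (tendsto_integral_resolventForm_sub_log H (hA.combo hB hc hd hcd) (hX.combo hY hc hd hcd))
    (((tendsto_integral_resolventForm_sub_log H hA hX).const_mul c).add
      ((tendsto_integral_resolventForm_sub_log H hB hY).const_mul d)) ?_
  filter_upwards [Filter.eventually_ge_atTop 0] with T hT
  have iA := (continuousOn_resolventForm H hA hX hT).intervalIntegrable (μ := MeasureTheory.volume)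
  have iB := (continuousOn_resolventForm H hB hY hT).intervalIntegrable (μ := MeasureTheory.volume)
  have h := intervalIntegral.integral_mono_on hT
    (continuousOn_resolventForm H (hA.combo hB hc hd hcd)
      (hX.combo hY hc hd hcd) hT).intervalIntegrable
    ((iA.const_mul c).add (iB.const_mul d))
    fun s hs => resolventForm_combo_le hs.1 H hA hB hX hY hc hd hcd
  rw [intervalIntegral.integral_add (iA.const_mul c) (iB.const_mul d),
    intervalIntegral.integral_const_mul, intervalIntegral.integral_const_mul] at h
  have ht : (Hᴴ * H * (c • X + d • Y)).trace.re =
      c * (Hᴴ * H * X).trace.re + d * (Hᴴ * H * Y).trace.re := by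
    simp [Matrix.mul_add, trace_add]
  rw [ht]
  linarith

/-! ### Gibbs variational principle and conclusion -/

/-- The Gibbs functional `Tr (X K) - Tr (X log X) + Tr X`. -/
noncomputable def gibbsFunctional (K X : Matrix n n ℂ) : ℝ :=
  (K * X).trace.re - (cfc (fun x : ℝ => x * Real.log x) X).trace.re + X.trace.re

lemma gibbsFunctional_le {K X : Matrix n n ℂ} (hK : K.IsHermitian) (hX : X.PosDef) :
    gibbsFunctional K X ≤ (NormedSpace.exp K).trace.re := by
  have h1 := re_trace_mul_cfc_mul_cfc_self hK hX.isHermitian 1 (fun _ => (1 : ℝ))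
    (fun x => x * Real.log x)
  have h2 := re_trace_mul_cfc_mul_cfc_self hK hX.isHermitian 1 (fun x : ℝ => x) (fun x : ℝ => x)
  have h3 := re_trace_mul_cfc_mul_cfc_self hK hX.isHermitian 1 (fun _ => (1 : ℝ)) (fun x : ℝ => x)
  have h4 := re_trace_mul_cfc_mul_cfc_self hK hX.isHermitian 1 Real.exp (fun _ => (1 : ℝ))
  simp only [hK.cfc_id_eq, hK.cfc_one_eq, hX.isHermitian.cfc_id_eq, hX.isHermitian.cfc_one_eq,
    one_mul, mul_one, conjTranspose_one] at h1 h2 h3 h4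
  rw [gibbsFunctional, hK.exp_eq_cfc, h1, h2, h3, h4, ← Finset.sum_sub_distrib,
    ← Finset.sum_add_distrib]
  refine Finset.sum_le_sum fun i _ => ?_
  rw [← Finset.sum_sub_distrib, ← Finset.sum_add_distrib]
  refine Finset.sum_le_sum fun j _ => ?_
  rw [← mul_sub, ← mul_add]
  refine mul_le_mul_of_nonneg_left ?_ (Complex.normSq_nonneg _)
  have hx := hX.eigenvalues_pos j
  set k := hK.eigenvalues i
  set x := hX.isHermitian.eigenvalues j
  -- Multiplied by `x`, this is the scalar Gibbs inequality `k x - x log x + x ≤ exp k`.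
  have h := Real.add_one_le_exp (k - Real.log x)
  rw [Real.exp_sub, Real.exp_log hx, le_div_iff₀ hx] at h
  linarith

lemma IsHermitian.posDef_exp {K : Matrix n n ℂ} (hK : K.IsHermitian) :
    (NormedSpace.exp K).PosDef := by
  rw [hK.exp_eq_cfc, hK.cfc_eq_mul_diagonal_mul]
  refine PosDef.mul_mul_conjTranspose_same ?_ ?_
  · exact PosDef.diagonal fun i => by exact_mod_cast Real.exp_pos _
  · exact vecMul_injective_of_isUnit
      (IsUnit.of_mul_eq_one _ (Unitary.coe_mul_star_self hK.eigenvectorUnitary))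

lemma gibbsFunctional_exp {K : Matrix n n ℂ} (hK : K.IsHermitian) :
    gibbsFunctional K (NormedSpace.exp K) = (NormedSpace.exp K).trace.re := by
  have hc : ∀ f : ℝ → ℝ, ContinuousOn f (spectrum ℝ K) := fun f =>
    (finite_real_spectrum (A := K)).continuousOn f
  have h1 : cfc (fun x : ℝ => x * Real.log x) (cfc Real.exp K) =
      cfc (fun x : ℝ => x * Real.exp x) K := by
    rw [← cfc_comp' (fun x : ℝ => x * Real.log x) Real.exp K
      (((finite_real_spectrum (A := K)).image _).continuousOn _) (hc _) hK.isSelfAdjoint]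
    simp [mul_comm]
  have h2 : K * cfc Real.exp K = cfc (fun x : ℝ => x * Real.exp x) K := by
    rw [cfc_mul (fun x : ℝ => x) Real.exp K (hc _) (hc _), hK.cfc_id_eq]
  rw [gibbsFunctional, hK.exp_eq_cfc, h1, h2]
  ring

open scoped Matrix.Norms.L2Operator MatrixOrder in
lemma exists_one_sub_eq_conjTranspose_mul_self {ι : Type*} [Fintype ι] {H : Matrix ι n ℂ}
    (hH : IsContraction H) :
    ∃ K : Matrix n n ℂ, 1 - Hᴴ * H = Kᴴ * K := by
  have hle : ‖Hᴴ * H‖ ≤ 1 := by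
    rw [l2_opNorm_conjTranspose_mul_self]
    exact mul_le_one₀ hH (norm_nonneg _) hH
  have h := (CStarAlgebra.norm_le_one_iff_of_nonneg (Hᴴ * H)
    (posSemidef_conjTranspose_mul_self H).nonneg).mp hle
  exact CStarAlgebra.nonneg_iff_eq_star_mul_self.mp (sub_nonneg.mpr h)

end Matrix

open Matrix in
theorem theorem2 {m n : Type*} [Fintype m] [DecidableEq m] [Fintype n] [DecidableEq n]
    (H : Matrix m n ℂ) (hH : IsContraction H) (L : Matrix n n ℂ) (hL : L.IsHermitian) :
    (∀ A : Matrix m m ℂ, A.PosDef → (traceExpLog H L A).im = 0) ∧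
      ConcaveOn ℝ {A : Matrix m m ℂ | A.PosDef} (fun A => (traceExpLog H L A).re) := by
  have hlog : ∀ A : Matrix m m ℂ, (matrixLog A).IsHermitian := fun A => cfc_predicate Real.log A
  have hK : ∀ A : Matrix m m ℂ, (L + Hᴴ * matrixLog A * H).IsHermitian := fun A =>
    hL.add (isHermitian_conjTranspose_mul_mul H (hlog A))
  refine ⟨fun A _ => ?_, fun A hA B hB c d hc hd hcd => hA.combo hB hc hd hcd, ?_⟩
  · have h := trace_conjTranspose (NormedSpace.exp (L + Hᴴ * matrixLog A * H))
    rw [(hK A).exp.eq] at h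
    exact Complex.conj_eq_iff_im.mp h.symm
  obtain ⟨K, hKH⟩ := exists_one_sub_eq_conjTranspose_mul_self hH
  -- `Tr (X log X)` is split along `1 = H* H + K* K`; as `log 1 = 0`, the `K` part is itself a
  -- weighted relative entropy.
  have key : ∀ (A : Matrix m m ℂ) (X : Matrix n n ℂ),
      gibbsFunctional (L + Hᴴ * matrixLog A * H) X =
        (L * X).trace.re + X.trace.re - weightedRelEntropy H A X -
          weightedRelEntropy K (1 : Matrix n n ℂ) X := by
    intro A X
    have h1 : cfc Real.log (1 : Matrix n n ℂ) = 0 := by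
      simp
    rw [gibbsFunctional, weightedRelEntropy, weightedRelEntropy, h1, ← hKH]
    simp only [matrixLog, Matrix.add_mul, Matrix.sub_mul, trace_add, trace_sub, Complex.add_re,
      Complex.sub_re, Matrix.one_mul, Matrix.mul_zero, Matrix.zero_mul, trace_zero,
      Complex.zero_re]
    ring
  intro A hA B hB c d hc hd hcd
  simp only [traceExpLog, smul_eq_mul]
  have hX := (hK A).posDef_exp
  have hY := (hK B).posDef_exp
  rw [← gibbsFunctional_exp (hK A), ← gibbsFunctional_exp (hK B)]
  -- The combination of the two maximizers serves as trial point for `c • A + d • B`.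
  refine le_trans ?_ (gibbsFunctional_le (hK (c • A + d • B)) (hX.combo hY hc hd hcd))
  generalize NormedSpace.exp (L + Hᴴ * matrixLog A * H) = X at *
  generalize NormedSpace.exp (L + Hᴴ * matrixLog B * H) = Y at *
  have e1 := weightedRelEntropy_combo_le H hA hB hX hY hc hd hcd
  have e2 := weightedRelEntropy_combo_le K (PosDef.one (n := n)) PosDef.one hX hY hc hd hcd
  rw [← add_smul, hcd, one_smul] at e2
  simp only [key, Matrix.mul_add, Matrix.mul_smul, trace_add, trace_smul, Complex.add_re,
    Complex.smul_re, smul_eq_mul]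
  linarith
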